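/- Let $M$ be a smooth (Hausdorff) $N$-dimensional manifold, $x\in M$, let $g_{ab}$ be a Lorentzian metric of signature $(+,-,\dots,-)$ on $T_xM$, and let $T_{ab}$ be a rank-2 covariant tensor at $x$. Write $(T\times T)_{ab}=T_{ac}T_b{}^c$, and for a smooth real function $\phi$ on $M$ put $$T_{ab}\{\phi\}=\nabla_a\phi\,\nabla_b\phi-\tfrac12(\nabla\phi\cdot\nabla\phi)\,g_{ab}\quad\text{at }x ,$$ the energy-momentum tensor of the minimally coupled massless scalar field $\phi$. Consider the conditions (R) $T_{ab}$ is symmetric, $(T\times T)_{ab}=f g_{ab}$ for some real $f$, $T_{ab}T^{ab}\ge 0$, and $T_a{}^a=\beta\sqrt{T_{ab}T^{ab}/N}$ with $\beta=N-2$ or $\beta=2-N$. Then: 1. Up to sign, $T_{ab}$ is algebraically the energy-momentum tensor of a scalar field if and only if (R) holds: there are $\epsilon\in\{1,-1\}$ and a smooth $\phi$ with $\epsilon T_{ab}=T_{ab}\{\phi\}$ at $x$ if and only if (R). 2. The sign is $+$ exactly under the dominant property: there is a smooth $\phi$ with $T_{ab}=T_{ab}\{\phi\}$ at $x$ if and only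 if (R) holds and $T_{ab}u^aw^b\ge 0$ for all future-pointing causal $u,w\in T_xM$ (for either choice of time-orientation). 3. If $N\neq 2$, the requirement $T_{ab}T^{ab}\ge0$ in (R) follows from symmetry and $(T\times T)_{ab}=fg_{ab}$. 4. Suppose $\epsilon\in\{1,-1\}$ and $\epsilon T_{ab}=T_{ab}\{\phi\}$ at $x$. If $\epsilon T_a{}^a=(N-2)\sqrt{T_{ab}T^{ab}/N}$ and $T_a{}^a\neq0$, then $d\phi$ is spacelike at $x$; if $\epsilon T_a{}^a=(2-N)\sqrt{T_{ab}T^{ab}/N}$ and $T_a{}^a\neq 0$, then $d\phi$ is timelike at $x$; if $T_a{}^a=0=T_{ab}T^{ab}$, then $d\phi$ is null at $x$ (nonzero with $\nabla\phi\cdot\nabla\phi=0$), or $T_{ab}=0$ and $d\phi=0$ at $x$. -/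

import Mathlib

open scoped Manifold ContDiff

noncomputable section

/-- A Lorentzian scalar product of signature `(+,-,…,-)` on a real vector space: symmetric, with a
vector of positive square whose orthogonal complement is negative definite. -/
structure LorentzForm (V : Type*) [AddCommGroup V] [Module ℝ V] where
  form : LinearMap.BilinForm ℝ V
  symm : ∀ u v, form u v = form v u
  signature : ∃ t, 0 < form t t ∧ ∀ v, v ≠ 0 → form t v = 0 → form v v < 0

namespace LorentzForm

variable {V : Type*} [AddCommGroup V] [Module ℝ V]

theorem nondegenerate (g : LorentzForm V) : g.form.Nondegenerate := by
  have key : ∀ v, (∀ w, g.form v w = 0) → v = 0 := by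
    intro v hv
    obtain ⟨t, -, ht⟩ := g.signature
    by_contra hne
    have h1 := ht v hne (by rw [g.symm]; exact hv t)
    rw [hv v] at h1
    exact lt_irrefl _ h1
  exact ⟨key, fun v hv => key v fun w => by rw [g.symm]; exact hv w⟩

variable [FiniteDimensional ℝ V]

/-- Raising an index: `α_a ↦ g^{ab} α_b`. -/
def sharp (g : LorentzForm V) : Module.Dual ℝ V →ₗ[ℝ] V :=
  (g.form.toDual g.nondegenerate).symm.toLinearMap

/-- The inverse metric on 1-forms: `α · β = g^{ab} α_a β_b`. -/
def cometric (g : LorentzForm V) : LinearMap.BilinForm ℝ (Module.Dual ℝ V) :=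
  g.form.compl₁₂ g.sharp g.sharp

/-- `(S × T)_{ab} = S_{ac} T_b{}^c = g^{cd} S_{ac} T_{bd}`. -/
def cross (g : LorentzForm V) (S T : LinearMap.BilinForm ℝ V) : LinearMap.BilinForm ℝ V :=
  g.cometric.compl₁₂ S T

/-- `T_a{}^a = g^{ab} T_{ab}`. -/
def metricTrace (g : LorentzForm V) (T : LinearMap.BilinForm ℝ V) : ℝ :=
  LinearMap.trace ℝ V (g.sharp ∘ₗ T)

/-- `S_{ab} T^{ab} = g^{ac} g^{bd} S_{ab} T_{cd}`, which is the trace of `S × T`. -/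
def contraction (g : LorentzForm V) (S T : LinearMap.BilinForm ℝ V) : ℝ :=
  g.metricTrace (g.cross S T)

/-- `α_a α_b - (1/2) (α · α) g_{ab}`. -/
def scalarEnergyMomentum (g : LorentzForm V) (α : Module.Dual ℝ V) : LinearMap.BilinForm ℝ V :=
  LinearMap.BilinForm.linMulLin α α - ((1 / 2 : ℝ) * g.cometric α α) • g.form

def IsSpacelike (g : LorentzForm V) (α : Module.Dual ℝ V) : Prop := g.cometric α α < 0

def IsTimelike (g : LorentzForm V) (α : Module.Dual ℝ V) : Prop := 0 < g.cometric α α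

def IsNull (g : LorentzForm V) (α : Module.Dual ℝ V) : Prop := α ≠ 0 ∧ g.cometric α α = 0

end LorentzForm

/-- `u` is causal and future-pointing, for the time-orientation given by the timelike vector `t`. -/
def LorentzForm.IsFutureCausal {V : Type*} [AddCommGroup V] [Module ℝ V]
    (g : LorentzForm V) (t u : V) : Prop :=
  0 ≤ g.form u u ∧ 0 < g.form t u

/-- The dominant property of a rank-2 tensor, for the time-orientation given by `t`. -/
def LorentzForm.HasDominantProperty {V : Type*} [AddCommGroup V] [Module ℝ V]
    (g : LorentzForm V) (t : V) (T : LinearMap.BilinForm ℝ V) : Prop :=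
  ∀ u w, g.IsFutureCausal t u → g.IsFutureCausal t w → 0 ≤ T u w

instance tangentSpace_finiteDimensional {N : ℕ} {M : Type*} [TopologicalSpace M]
    [ChartedSpace (EuclideanSpace ℝ (Fin N)) M] (x : M) :
    FiniteDimensional ℝ (TangentSpace (𝓡 N) x) :=
  inferInstanceAs (FiniteDimensional ℝ (EuclideanSpace ℝ (Fin N)))

/-- The 1-form `dφ` at the point `x`. -/
def differentialAt {N : ℕ} {M : Type*} [TopologicalSpace M]
    [ChartedSpace (EuclideanSpace ℝ (Fin N)) M] (φ : M → ℝ) (x : M) :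
    Module.Dual ℝ (TangentSpace (𝓡 N) x) :=
  (mvfderiv (𝓡 N) φ x).toLinearMap

/-- `T` is, at the point `x`, the energy-momentum tensor
`∇_a φ ∇_b φ - (1/2) (∇φ · ∇φ) g_{ab}` of the smooth scalar field `φ`. -/
def IsScalarFieldTensorAt {N : ℕ} {M : Type*} [TopologicalSpace M]
    [ChartedSpace (EuclideanSpace ℝ (Fin N)) M] {x : M}
    (g : LorentzForm (TangentSpace (𝓡 N) x)) (T : LinearMap.BilinForm ℝ (TangentSpace (𝓡 N) x))
    (φ : M → ℝ) : Prop :=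
  ContMDiff (𝓡 N) 𝓘(ℝ, ℝ) ∞ φ ∧ T = g.scalarEnergyMomentum (differentialAt φ x)

/-- The algebraic Rainich conditions of a massless scalar field in dimension `N`: `T` is symmetric,
`(T × T)_{ab} = f g_{ab}` for some scalar `f`, `T_{ab} T^{ab}` is nonnegative (so that the square
root makes sense), and `T_a{}^a = ± (N - 2) √(T_{ab} T^{ab} / N)`. -/
def ScalarRainichConditions {V : Type*} [AddCommGroup V] [Module ℝ V] [FiniteDimensional ℝ V]
    (N : ℕ) (g : LorentzForm V) (T : LinearMap.BilinForm ℝ V) : Prop :=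
  (∀ u v, T u v = T v u) ∧
  (∃ f : ℝ, g.cross T T = f • g.form) ∧
  0 ≤ g.contraction T T ∧
  ∃ β : ℝ, (β = (N : ℝ) - 2 ∨ β = 2 - (N : ℝ)) ∧
    g.metricTrace T = β * √(g.contraction T T / (N : ℝ))

end

/-! Every covector at `x` is the differential of a smooth function
(`exists_contMDiff_differentialAt_eq`), so the theorem is linear algebra about `α ⊗ α - ½(α·α)g`.
Let `A` be the mixed tensor of `T`; for symmetric `T`, the condition `T × T = f g` says `A² = f`. If
`f = s² > 0`, the trace condition gives, after possibly replacing `T` by `-T`, `tr A = (2 - N)s`.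
Then `(A + s)/(2s)` is a self-adjoint idempotent of trace 1, the projection onto a non-null line,
and a generator of that line, rescaled, is `α`. If `f = 0`, the image of `A` is totally isotropic,
hence at most a line, and `T = k n ⊗ n` with `n` null. The sign is settled by `T(t,t) ≥ α(t)²/2` for
the tensor of `α`, a form of reverse Cauchy-Schwarz. The causal character is read off from `tr A =
(2 - N)(α·α)/2` and `√(T·T/N) = |α·α|/2`. -/

namespace LorentzForm

section Algebra

variable {V : Type*} [AddCommGroup V] [Module ℝ V] (g : LorentzForm V)

/-! ### Vectors in Lorentzian signature. -/

theorem eq_of_forall_form_eq {u v : V} (h : ∀ w, g.form u w = g.form v w) : u = v := by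
  rw [← sub_eq_zero]
  exact g.nondegenerate.1 _ fun w => by rw [map_sub, LinearMap.sub_apply, h w, sub_self]

/-- The orthogonal complement of any timelike vector is negative definite. -/
theorem form_self_neg_of_orthogonal {t v : V} (ht : 0 < g.form t t) (hv : v ≠ 0)
    (htv : g.form t v = 0) : g.form v v < 0 := by
  obtain ⟨s, -, hs⟩ := g.signature
  by_contra! hvv
  -- This combination of `v` and `t` is orthogonal to `s`, yet its square is nonnegative, so it
  -- vanishes; pairing it with `t` gives `g(s,v) = 0`.
  have hx : 0 ≤ g.form (g.form s t • v - g.form s v • t) (g.form s t • v - g.form s v • t) := by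
    have : g.form (g.form s t • v - g.form s v • t) (g.form s t • v - g.form s v • t) =
        g.form s t ^ 2 * g.form v v + g.form s v ^ 2 * g.form t t := by
      simp only [map_sub, map_smul, LinearMap.sub_apply, LinearMap.smul_apply, smul_eq_mul,
        g.symm v t, htv]
      ring
    rw [this]
    positivity
  have hx0 : g.form s t • v - g.form s v • t = 0 := by
    by_contra hne
    refine absurd (hs _ hne ?_) (not_lt.mpr hx)
    simp only [map_sub, map_smul, smul_eq_mul]
    ring
  have hsv : g.form s v * g.form t t = 0 := by
    have := congrArg (g.form t) hx0
    simpa [htv] using this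
  have hsv0 : g.form s v = 0 := (mul_eq_zero.mp hsv).resolve_right ht.ne'
  exact absurd (hs v hv hsv0) (not_lt.mpr hvv)

theorem form_self_nonpos_of_orthogonal {t v : V} (ht : 0 < g.form t t)
    (htv : g.form t v = 0) : g.form v v ≤ 0 := by
  rcases eq_or_ne v 0 with rfl | hv
  · simp
  · exact (g.form_self_neg_of_orthogonal ht hv htv).le

theorem eq_zero_of_orthogonal {t v : V} (ht : 0 < g.form t t)
    (htv : g.form t v = 0) (hv : 0 ≤ g.form v v) : v = 0 := by
  by_contra hne
  exact absurd (g.form_self_neg_of_orthogonal ht hne htv) (not_lt.mpr hv)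

/-- The reverse Cauchy-Schwarz inequality. -/
theorem form_mul_form_le_sq {t : V} (ht : 0 < g.form t t) (a : V) :
    g.form a a * g.form t t ≤ g.form a t ^ 2 := by
  have h := g.form_self_nonpos_of_orthogonal (v := g.form t t • a - g.form a t • t) ht (by
    simp only [map_sub, map_smul, smul_eq_mul, g.symm t a]
    ring)
  simp only [map_sub, map_smul, LinearMap.sub_apply, LinearMap.smul_apply, smul_eq_mul,
    g.symm t a] at h
  have h' : g.form t t * (g.form a a * g.form t t - g.form a t ^ 2) ≤ 0 := by linarith
  nlinarith [nonpos_of_mul_nonpos_right h' ht]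

/-- Causal vectors in the same closed half cone have a nonnegative product. -/
theorem form_nonneg_of_causal {t p q : V} (ht : 0 < g.form t t) (hp : 0 ≤ g.form p p)
    (hq : 0 ≤ g.form q q) (htp : 0 ≤ g.form t p) (htq : 0 ≤ g.form t q) : 0 ≤ g.form p q := by
  rcases htp.eq_or_lt with h | h
  · simp [g.eq_zero_of_orthogonal ht h.symm hp]
  rcases htq.eq_or_lt with h' | h'
  · simp [g.eq_zero_of_orthogonal ht h'.symm hq]
  have hv := g.form_self_nonpos_of_orthogonal (v := g.form t q • p - g.form t p • q) ht (by
    simp only [map_sub, map_smul, smul_eq_mul]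
    ring)
  simp only [map_sub, map_smul, LinearMap.sub_apply, LinearMap.smul_apply, smul_eq_mul,
    g.symm q p] at hv
  have h1 : 0 ≤ g.form t q ^ 2 * g.form p p + g.form t p ^ 2 * g.form q q := by positivity
  have h2 : 0 ≤ (g.form t p * g.form t q) * g.form p q := by linarith
  exact nonneg_of_mul_nonneg_right h2 (mul_pos h h')

theorem smul_smul_self_of_sign {ε : ℝ} (hε : ε = 1 ∨ ε = -1) (T : LinearMap.BilinForm ℝ V) :
    ε • ε • T = T := by
  rcases hε with rfl | rfl <;> ext <;> simp

/-! ### Index raising, traces and contractions. -/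

variable [FiniteDimensional ℝ V]

@[simp]
theorem form_sharp (α : Module.Dual ℝ V) (v : V) : g.form (g.sharp α) v = α v :=
  LinearMap.BilinForm.apply_toDual_symm_apply α v

theorem sharp_form (v : V) : g.sharp (g.form v) = v :=
  g.eq_of_forall_form_eq fun w => by simp

theorem form_sharp' (α : Module.Dual ℝ V) (v : V) : g.form v (g.sharp α) = α v := by
  rw [g.symm, g.form_sharp]

theorem cometric_apply (α β : Module.Dual ℝ V) : g.cometric α β = α (g.sharp β) :=
  g.form_sharp α (g.sharp β)

/-- The mixed tensor `T_a{}^b`, as an endomorphism. -/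
noncomputable def mixed (T : LinearMap.BilinForm ℝ V) : V →ₗ[ℝ] V := g.sharp ∘ₗ T

@[simp]
theorem form_mixed (T : LinearMap.BilinForm ℝ V) (u v : V) : g.form (g.mixed T u) v = T u v :=
  g.form_sharp (T u) v

theorem metricTrace_eq (T : LinearMap.BilinForm ℝ V) :
    g.metricTrace T = LinearMap.trace ℝ V (g.mixed T) := rfl

theorem cross_apply (S T : LinearMap.BilinForm ℝ V) (u v : V) :
    g.cross S T u v = g.form (g.mixed S u) (g.mixed T v) := rfl

theorem mixed_smul (c : ℝ) (T : LinearMap.BilinForm ℝ V) : g.mixed (c • T) = c • g.mixed T := by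
  simp [mixed, LinearMap.comp_smul]

theorem mixed_form : g.mixed g.form = LinearMap.id :=
  LinearMap.ext g.sharp_form

theorem metricTrace_smul (c : ℝ) (T : LinearMap.BilinForm ℝ V) :
    g.metricTrace (c • T) = c * g.metricTrace T := by
  simp [metricTrace_eq, mixed_smul]

theorem metricTrace_form : g.metricTrace g.form = Module.finrank ℝ V := by
  rw [metricTrace_eq, mixed_form, LinearMap.trace_id]

theorem cross_smul_smul (c : ℝ) (T : LinearMap.BilinForm ℝ V) :
    g.cross (c • T) (c • T) = c ^ 2 • g.cross T T := by
  ext u v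
  simp only [cross_apply, mixed_smul, LinearMap.smul_apply, map_smul, smul_eq_mul]
  ring

theorem contraction_smul_smul (c : ℝ) (T : LinearMap.BilinForm ℝ V) :
    g.contraction (c • T) (c • T) = c ^ 2 * g.contraction T T := by
  rw [contraction, cross_smul_smul, metricTrace_smul, contraction]

theorem contraction_of_cross_eq {T : LinearMap.BilinForm ℝ V} {f : ℝ}
    (h : g.cross T T = f • g.form) : g.contraction T T = f * Module.finrank ℝ V := by
  rw [contraction, h, metricTrace_smul, metricTrace_form]

theorem finrank_pos (g : LorentzForm V) : 0 < Module.finrank ℝ V := by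
  obtain ⟨t, ht, -⟩ := g.signature
  have : Nontrivial V := ⟨t, 0, by rintro rfl; simp at ht⟩
  exact Module.finrank_pos

theorem mixed_mixed {T : LinearMap.BilinForm ℝ V} (hT : ∀ u v, T u v = T v u) {f : ℝ}
    (h : g.cross T T = f • g.form) (v : V) : g.mixed T (g.mixed T v) = f • v := by
  refine g.eq_of_forall_form_eq fun w => ?_
  rw [form_mixed, hT, ← form_mixed, ← cross_apply, h]
  simp [g.symm w v]

/-! ### The energy-momentum tensor of a 1-form -/

theorem scalarEnergyMomentum_apply (α : Module.Dual ℝ V) (u v : V) :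
    g.scalarEnergyMomentum α u v = α u * α v - 1 / 2 * g.cometric α α * g.form u v := by
  simp [scalarEnergyMomentum]

theorem scalarEnergyMomentum_symm (α : Module.Dual ℝ V) (u v : V) :
    g.scalarEnergyMomentum α u v = g.scalarEnergyMomentum α v u := by
  rw [scalarEnergyMomentum_apply, scalarEnergyMomentum_apply, g.symm u v]
  ring

theorem mixed_scalarEnergyMomentum (α : Module.Dual ℝ V) (v : V) :
    g.mixed (g.scalarEnergyMomentum α) v =
      α v • g.sharp α - (1 / 2 * g.cometric α α) • v := by
  refine g.eq_of_forall_form_eq fun w => ?_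
  simp [scalarEnergyMomentum_apply]

/-- With `q = α·α`, the mixed tensor is `q/2` on the raised `α` and `-q/2` on `ker α`. The direct
computation also covers null `α`: the `α ⊗ α` terms cancel. -/
theorem cross_scalarEnergyMomentum (α : Module.Dual ℝ V) :
    g.cross (g.scalarEnergyMomentum α) (g.scalarEnergyMomentum α) =
      (g.cometric α α / 2) ^ 2 • g.form := by
  ext u v
  rw [cross_apply, mixed_scalarEnergyMomentum, mixed_scalarEnergyMomentum]
  simp only [map_sub, map_smul, LinearMap.sub_apply, LinearMap.smul_apply, smul_eq_mul,
    form_sharp, g.form_sharp' α, g.cometric_apply α α]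
  ring

theorem contraction_scalarEnergyMomentum (α : Module.Dual ℝ V) :
    g.contraction (g.scalarEnergyMomentum α) (g.scalarEnergyMomentum α) =
      (g.cometric α α / 2) ^ 2 * Module.finrank ℝ V :=
  g.contraction_of_cross_eq (g.cross_scalarEnergyMomentum α)

theorem metricTrace_scalarEnergyMomentum (α : Module.Dual ℝ V) :
    g.metricTrace (g.scalarEnergyMomentum α) =
      (2 - (Module.finrank ℝ V : ℝ)) * (g.cometric α α / 2) := by
  have h : g.mixed (g.scalarEnergyMomentum α) =
      α.smulRight (g.sharp α) - (1 / 2 * g.cometric α α) • LinearMap.id :=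
    LinearMap.ext fun v => by simp [mixed_scalarEnergyMomentum]
  rw [metricTrace_eq, h, map_sub, map_smul, LinearMap.trace_id, LinearMap.trace_smulRight,
    ← cometric_apply, smul_eq_mul]
  ring

theorem sqrt_contraction_scalarEnergyMomentum (α : Module.Dual ℝ V) :
    √(g.contraction (g.scalarEnergyMomentum α) (g.scalarEnergyMomentum α) /
      (Module.finrank ℝ V : ℝ)) = |g.cometric α α / 2| := by
  have h : (Module.finrank ℝ V : ℝ) ≠ 0 := by exact_mod_cast (finrank_pos g).ne'
  rw [contraction_scalarEnergyMomentum, mul_div_cancel_right₀ _ h, Real.sqrt_sq_eq_abs]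

theorem scalarRainichConditions_scalarEnergyMomentum (α : Module.Dual ℝ V) :
    ScalarRainichConditions (Module.finrank ℝ V) g (g.scalarEnergyMomentum α) := by
  refine ⟨g.scalarEnergyMomentum_symm α, ⟨_, g.cross_scalarEnergyMomentum α⟩, ?_, ?_⟩
  · rw [contraction_scalarEnergyMomentum]
    positivity
  · rw [sqrt_contraction_scalarEnergyMomentum, metricTrace_scalarEnergyMomentum]
    rcases abs_cases (g.cometric α α / 2) with ⟨h, -⟩ | ⟨h, -⟩ <;> rw [h]
    · exact ⟨_, Or.inr rfl, rfl⟩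
    · exact ⟨_, Or.inl rfl, by ring⟩

theorem scalarRainichConditions_smul {N : ℕ} {T : LinearMap.BilinForm ℝ V} {ε : ℝ}
    (hε : ε = 1 ∨ ε = -1) (h : ScalarRainichConditions N g T) :
    ScalarRainichConditions N g (ε • T) := by
  obtain ⟨hs, ⟨f, hf⟩, h0, β, hβ, htr⟩ := h
  have hε2 : ε ^ 2 = 1 := by rcases hε with rfl | rfl <;> norm_num
  have hc : g.contraction (ε • T) (ε • T) = g.contraction T T := by
    rw [contraction_smul_smul, hε2, one_mul]
  refine ⟨fun u v => by simp [hs u v], ⟨f, ?_⟩, hc ▸ h0, ε * β, ?_, ?_⟩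
  · rw [cross_smul_smul, hf, hε2, one_smul]
  · rcases hε with rfl | rfl
    · rwa [one_mul]
    · rcases hβ with rfl | rfl
      · exact Or.inr (by ring)
      · exact Or.inl (by ring)
  · rw [hc, metricTrace_smul, htr]
    ring

/-! ### Recovering the 1-form -/

/-- Here `ε` is the sign of `g(w,w)`, and `α` is a multiple of `g(w,·)` scaled so that `α·α = 2sε`.
-/
theorem exists_eq_scalarEnergyMomentum_of_vector {T : LinearMap.BilinForm ℝ V} {s : ℝ}
    (hs : 0 < s) {w : V} (hw : g.form w w ≠ 0)
    (hT : ∀ u v, T u v = 2 * s / g.form w w * g.form w u * g.form w v - s * g.form u v) :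
    ∃ ε : ℝ, (ε = 1 ∨ ε = -1) ∧ ∃ α, ε • T = g.scalarEnergyMomentum α := by
  obtain ⟨ε, hε, hpos⟩ : ∃ ε : ℝ, (ε = 1 ∨ ε = -1) ∧ 0 < ε * g.form w w := by
    rcases hw.lt_or_gt with h | h
    · exact ⟨-1, Or.inr rfl, by linarith⟩
    · exact ⟨1, Or.inl rfl, by linarith⟩
  have hε2 : ε * ε = 1 := by rcases hε with rfl | rfl <;> norm_num
  have hε0 : ε ≠ 0 := left_ne_zero_of_mul_eq_one hε2
  set c : ℝ := √(2 * s / (ε * g.form w w))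
  have hc : c * c = 2 * s / (ε * g.form w w) := Real.mul_self_sqrt (by positivity)
  have hinv : 2 * s / (ε * g.form w w) = ε * (2 * s / g.form w w) := by
    field_simp
    linear_combination (-1 : ℝ) * hε2
  refine ⟨ε, hε, c • g.form w, ?_⟩
  have hα : g.cometric (c • g.form w) (c • g.form w) = ε * (2 * s) := by
    simp only [cometric_apply, map_smul, sharp_form, LinearMap.smul_apply, smul_eq_mul]
    rw [← mul_assoc, hc, hinv]
    field_simp
  ext u v
  rw [scalarEnergyMomentum_apply, hα]
  simp only [LinearMap.smul_apply, smul_eq_mul, hT]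
  linear_combination (-(g.form w u * g.form w v)) * (hc.trans hinv)

theorem exists_eq_scalarEnergyMomentum_of_trace_eq {T : LinearMap.BilinForm ℝ V}
    (hT : ∀ u v, T u v = T v u) {s : ℝ} (hs : 0 < s) (hcross : g.cross T T = s ^ 2 • g.form)
    (htr : g.metricTrace T = (2 - (Module.finrank ℝ V : ℝ)) * s) :
    ∃ ε : ℝ, (ε = 1 ∨ ε = -1) ∧ ∃ α, ε • T = g.scalarEnergyMomentum α := by
  -- As `A² = s²`, this is the projection onto the eigenspace of `s` along that of `-s`.
  set P : V →ₗ[ℝ] V := (1 / (2 * s)) • (g.mixed T + s • LinearMap.id) with hP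
  have hPv (v : V) : P v = (1 / (2 * s)) • (g.mixed T v + s • v) := rfl
  have hTP (u v : V) : T u v = 2 * s * g.form (P u) v - s * g.form u v := by
    rw [hPv]
    simp only [map_add, map_smul, LinearMap.add_apply, LinearMap.smul_apply, smul_eq_mul,
      form_mixed]
    field_simp
    ring
  have hidem : IsIdempotentElem P := by
    refine LinearMap.ext fun v => ?_
    change P (P v) = P v
    rw [hPv (P v), hPv v]
    simp only [map_add, map_smul, g.mixed_mixed hT hcross]
    match_scalars <;> field_simp <;> ring
  have hadj (u v : V) : g.form (P u) v = g.form u (P v) := by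
    have h1 := hTP u v
    have h2 := hTP v u
    rw [hT v u, g.symm v u, g.symm (P v) u] at h2
    have h3 : (2 * s) * g.form (P u) v = (2 * s) * g.form u (P v) := by linarith
    exact mul_left_cancel₀ (by positivity) h3
  -- The rank of an idempotent is its trace, here `((2 - N)s + Ns)/(2s) = 1`.
  have hrank : Module.finrank ℝ (LinearMap.range P) = 1 := by
    have h1 : LinearMap.trace ℝ V P = 1 := by
      rw [hP, map_smul, map_add, map_smul, LinearMap.trace_id, ← metricTrace_eq, htr]
      simp only [smul_eq_mul]
      field_simp
      ring
    have h2 := (LinearMap.IsIdempotentElem.isProj_range P hidem).trace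
    rw [h1] at h2
    exact_mod_cast h2.symm
  obtain ⟨⟨w, hwP⟩, hw0, hspan⟩ := finrank_eq_one_iff'.mp hrank
  have hspan' (v : V) : ∃ c : ℝ, c • w = P v := by
    obtain ⟨c, hc⟩ := hspan ⟨P v, v, rfl⟩
    exact ⟨c, congrArg Subtype.val hc⟩
  have hPw : P w = w := by
    obtain ⟨v, rfl⟩ := hwP
    exact LinearMap.congr_fun hidem v
  have hform (v : V) : ∃ c : ℝ, c • w = P v ∧ g.form w v = c * g.form w w := by
    obtain ⟨c, hc⟩ := hspan' v
    refine ⟨c, hc, ?_⟩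
    conv_lhs => rw [← hPw]
    rw [hadj, ← hc, map_smul, smul_eq_mul]
  -- Self-adjointness of `P` makes `g(w,v)` a multiple of `g(w,w)`, so a null `w` would lie in the
  -- radical.
  have hww : g.form w w ≠ 0 := by
    intro h0
    refine hw0 (Subtype.ext (g.nondegenerate.1 w fun v => ?_))
    obtain ⟨c, -, hc⟩ := hform v
    rw [hc, h0, mul_zero]
  refine g.exists_eq_scalarEnergyMomentum_of_vector hs hww fun u v => ?_
  obtain ⟨c, hc, hcu⟩ := hform u
  rw [hTP, ← hc, hcu, map_smul, LinearMap.smul_apply, smul_eq_mul]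
  field_simp

theorem exists_eq_scalarEnergyMomentum_of_cross_eq_zero {T : LinearMap.BilinForm ℝ V}
    (hT : ∀ u v, T u v = T v u) (hcross : g.cross T T = 0) :
    ∃ ε : ℝ, (ε = 1 ∨ ε = -1) ∧ ∃ α, ε • T = g.scalarEnergyMomentum α := by
  by_cases h0 : g.mixed T = 0
  · refine ⟨1, Or.inl rfl, 0, ?_⟩
    ext u v
    rw [scalarEnergyMomentum_apply, LinearMap.smul_apply, LinearMap.smul_apply,
      ← g.form_mixed T u v, h0]
    simp
  obtain ⟨u₀, hu₀⟩ : ∃ u, g.mixed T u ≠ 0 := by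
    by_contra! h
    exact h0 (LinearMap.ext h)
  obtain ⟨t, ht, -⟩ := g.signature
  have hiso (u v : V) : g.form (g.mixed T u) (g.mixed T v) = 0 := by
    rw [← cross_apply, hcross]
    rfl
  set n := g.mixed T u₀
  have htn : g.form t n ≠ 0 := fun h => hu₀ (g.eq_zero_of_orthogonal ht h (hiso _ _).ge)
  -- Mutually orthogonal null vectors are parallel: the difference of the two sides is null and
  -- orthogonal to `t`.
  have hmix (v : V) : g.form t n • g.mixed T v = g.form t (g.mixed T v) • n := by
    rw [← sub_eq_zero]
    refine g.eq_zero_of_orthogonal ht ?_ ?_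
    · simp only [map_sub, map_smul, smul_eq_mul]
      ring
    · simp only [map_sub, map_smul, LinearMap.sub_apply, LinearMap.smul_apply, smul_eq_mul, n, hiso,
        mul_zero, sub_zero, le_refl]
  have hTn (u v : V) : g.form t n * T u v = T t u * g.form n v := by
    have := congrArg (fun x => g.form x v) (hmix u)
    simpa [g.symm t (g.mixed T u), hT u t] using this
  -- exchanging the arguments shows that `T t` is a multiple of `g n`
  set k : ℝ := T t t / g.form t n ^ 2
  have hTk (u v : V) : T u v = k * g.form n u * g.form n v := by
    have h1 := hTn u v
    have h2 := hTn t u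
    rw [eq_div_of_mul_eq htn ((mul_comm _ _).trans h1),
      eq_div_of_mul_eq htn ((mul_comm _ _).trans h2)]
    simp only [k]
    field_simp
  obtain ⟨ε, hε, hk⟩ : ∃ ε : ℝ, (ε = 1 ∨ ε = -1) ∧ 0 ≤ ε * k := by
    rcases le_total 0 k with h | h
    · exact ⟨1, Or.inl rfl, by linarith⟩
    · exact ⟨-1, Or.inr rfl, by linarith⟩
  refine ⟨ε, hε, √(ε * k) • g.form n, ?_⟩
  have hα : g.cometric (√(ε * k) • g.form n) (√(ε * k) • g.form n) = 0 := by
    simp [cometric_apply, sharp_form, n, hiso]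
  ext u v
  rw [scalarEnergyMomentum_apply, hα]
  simp only [LinearMap.smul_apply, smul_eq_mul, hTk]
  linear_combination (-(g.form n u * g.form n v)) * Real.mul_self_sqrt hk

theorem scalarRainichConditions_iff (T : LinearMap.BilinForm ℝ V) :
    ScalarRainichConditions (Module.finrank ℝ V) g T ↔
      ∃ ε : ℝ, (ε = 1 ∨ ε = -1) ∧ ∃ α, ε • T = g.scalarEnergyMomentum α := by
  constructor
  · rintro ⟨hT, ⟨f, hf⟩, h0, β, hβ, htr⟩
    have hN : (0 : ℝ) < Module.finrank ℝ V := by exact_mod_cast (finrank_pos g)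
    rw [g.contraction_of_cross_eq hf] at h0 htr
    rw [mul_div_cancel_right₀ _ hN.ne'] at htr
    have hf0 : 0 ≤ f := nonneg_of_mul_nonneg_left h0 hN
    rcases hf0.eq_or_lt with rfl | hpos
    · exact g.exists_eq_scalarEnergyMomentum_of_cross_eq_zero hT (by simpa using hf)
    have hs := Real.sqrt_pos.mpr hpos
    rw [← Real.sq_sqrt hf0] at hf
    rcases hβ with rfl | rfl
    · obtain ⟨ε, hε, α, hα⟩ := g.exists_eq_scalarEnergyMomentum_of_trace_eq (T := (-1 : ℝ) • T)
        (fun u v => by simp [hT u v]) hs (by rw [cross_smul_smul, hf]; norm_num)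
        (by rw [metricTrace_smul, htr]; ring)
      exact ⟨ε * -1, by rcases hε with rfl | rfl <;> norm_num, α, by rw [← hα, smul_smul]⟩
    · exact g.exists_eq_scalarEnergyMomentum_of_trace_eq hT hs hf htr
  · rintro ⟨ε, hε, α, hα⟩
    have h := g.scalarRainichConditions_scalarEnergyMomentum α
    rw [← hα] at h
    simpa only [smul_smul_self_of_sign hε] using g.scalarRainichConditions_smul hε h

/-! ### The dominant property -/

theorem le_scalarEnergyMomentum_self {t : V} (ht : 0 < g.form t t) (α : Module.Dual ℝ V) :
    α t ^ 2 / 2 ≤ g.scalarEnergyMomentum α t t := by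
  have h := g.form_mul_form_le_sq ht (g.sharp α)
  rw [form_sharp, form_sharp, ← cometric_apply] at h
  rw [scalarEnergyMomentum_apply]
  linarith

/-- The mixed tensor multiplies squares by `(α·α/2)² ≥ 0`, so it preserves causality; the bound on
`T(t,t)` fixes the half cone for the image of `t`, and symmetry of `T` carries this over to the
image of `u`. -/
theorem hasDominantProperty_scalarEnergyMomentum {t : V} (ht : 0 < g.form t t)
    (α : Module.Dual ℝ V) : g.HasDominantProperty t (g.scalarEnergyMomentum α) := by
  rintro u w ⟨hu, htu⟩ ⟨hw, htw⟩
  set T := g.scalarEnergyMomentum α with hTdef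
  have hsq (v : V) (hv : 0 ≤ g.form v v) : 0 ≤ g.form (g.mixed T v) (g.mixed T v) := by
    rw [← cross_apply, hTdef, cross_scalarEnergyMomentum, LinearMap.smul_apply,
      LinearMap.smul_apply, smul_eq_mul]
    positivity
  have htt : 0 ≤ g.form t (g.mixed T t) := by
    rw [g.symm, form_mixed]
    exact le_trans (by positivity) (g.le_scalarEnergyMomentum_self ht α)
  have htu' : 0 ≤ g.form t (g.mixed T u) := by
    rw [g.symm, form_mixed, hTdef, scalarEnergyMomentum_symm, ← form_mixed]
    exact g.form_nonneg_of_causal ht (hsq t ht.le) hu htt htu.le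
  rw [← form_mixed]
  exact g.form_nonneg_of_causal ht (hsq u hu) hw htu' htw.le

theorem exists_eq_scalarEnergyMomentum_iff {t : V} (ht : 0 < g.form t t)
    (T : LinearMap.BilinForm ℝ V) :
    (∃ α, T = g.scalarEnergyMomentum α) ↔
      ScalarRainichConditions (Module.finrank ℝ V) g T ∧ g.HasDominantProperty t T := by
  constructor
  · rintro ⟨α, rfl⟩
    exact ⟨g.scalarRainichConditions_scalarEnergyMomentum α,
      g.hasDominantProperty_scalarEnergyMomentum ht α⟩
  · rintro ⟨hR, hD⟩
    obtain ⟨ε, rfl | rfl, α, hα⟩ := (g.scalarRainichConditions_iff T).mp hR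
    · exact ⟨α, by simpa using hα⟩
    -- For `ε = -1`, dominance and the lower bound force `α(t) = 0`. Then the raised `α` is
    -- orthogonal to `t` with nonnegative square, so `α = 0` and `T = 0`.
    have h1 := hD t t ⟨ht.le, ht⟩ ⟨ht.le, ht⟩
    have h2 := g.le_scalarEnergyMomentum_self ht α
    have h3 : g.scalarEnergyMomentum α t t = -T t t := by rw [← hα]; simp
    have h4 : α t = 0 := by
      have : α t ^ 2 ≤ 0 := by linarith
      exact pow_eq_zero_iff two_ne_zero |>.mp (le_antisymm this (sq_nonneg _))
    have h5 : g.cometric α α * g.form t t ≥ 0 := by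
      rw [scalarEnergyMomentum_apply, h4] at h3
      linarith
    have h6 : 0 ≤ g.form (g.sharp α) (g.sharp α) := nonneg_of_mul_nonneg_left h5 ht
    have h7 : g.sharp α = 0 := g.eq_zero_of_orthogonal ht (by rw [form_sharp', h4]) h6
    have h8 : α = 0 := by
      ext v
      rw [← g.form_sharp α v, h7]
      simp
    refine ⟨α, ?_⟩
    rw [← smul_smul_self_of_sign (Or.inr rfl) T, hα, h8]
    ext u v
    simp [scalarEnergyMomentum_apply]

/-! ### Dimensions other than two -/

/-- If `f < 0`, then `A` reverses the sign of squares, so no nonzero `v` has both `v` and `Av`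
orthogonal to `t`. These two linear conditions bound the dimension by 2; in dimension 1, `A` is a
scalar whose square would be `f`. -/
theorem contraction_nonneg (hN : Module.finrank ℝ V ≠ 2) {T : LinearMap.BilinForm ℝ V}
    (hT : ∃ f : ℝ, g.cross T T = f • g.form) : 0 ≤ g.contraction T T := by
  obtain ⟨f, hf⟩ := hT
  rw [g.contraction_of_cross_eq hf]
  refine mul_nonneg ?_ (Nat.cast_nonneg _)
  by_contra! hneg
  obtain ⟨t, ht, -⟩ := g.signature
  have hA (u v : V) : g.form (g.mixed T u) (g.mixed T v) = f * g.form u v := by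
    rw [← cross_apply, hf]
    rfl
  have ht0 : t ≠ 0 := by rintro rfl; simp at ht
  have hle : Module.finrank ℝ V ≤ 2 := by
    have hinj : Function.Injective ((g.form t).prod (g.form t ∘ₗ g.mixed T)) := by
      rw [← LinearMap.ker_eq_bot, LinearMap.ker_eq_bot']
      intro v hv
      have h1 : g.form t v = 0 := congrArg Prod.fst hv
      have h2 : g.form t (g.mixed T v) = 0 := congrArg Prod.snd hv
      have h3 := g.form_self_nonpos_of_orthogonal ht h2
      rw [hA] at h3
      exact g.eq_zero_of_orthogonal ht h1 (by nlinarith)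
    simpa using LinearMap.finrank_le_finrank_of_injective hinj
  have hone : Module.finrank ℝ V = 1 := by
    have := (finrank_pos g)
    omega
  obtain ⟨c, hc⟩ := (finrank_eq_one_iff_of_nonzero' t ht0).mp hone (g.mixed T t)
  have h := hA t t
  rw [← hc] at h
  simp only [map_smul, LinearMap.smul_apply, smul_eq_mul] at h
  nlinarith [mul_nonneg (mul_self_nonneg c) ht.le]

/-! ### The causal character of the 1-form -/

variable {g} {T : LinearMap.BilinForm ℝ V} {α : Module.Dual ℝ V} {ε : ℝ}

theorem sign_mul_metricTrace (hα : ε • T = g.scalarEnergyMomentum α) :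
    ε * g.metricTrace T = (2 - (Module.finrank ℝ V : ℝ)) * (g.cometric α α / 2) := by
  rw [← metricTrace_smul, hα, metricTrace_scalarEnergyMomentum]

theorem contraction_eq_of_sign (hε : ε = 1 ∨ ε = -1) (hα : ε • T = g.scalarEnergyMomentum α) :
    g.contraction T T = (g.cometric α α / 2) ^ 2 * Module.finrank ℝ V := by
  rw [← contraction_scalarEnergyMomentum, ← hα, contraction_smul_smul]
  rcases hε with rfl | rfl <;> norm_num

theorem sqrt_contraction_of_sign (hε : ε = 1 ∨ ε = -1) (hα : ε • T = g.scalarEnergyMomentum α) :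
    √(g.contraction T T / (Module.finrank ℝ V : ℝ)) = |g.cometric α α| / 2 := by
  rw [contraction_eq_of_sign hε hα, ← contraction_scalarEnergyMomentum,
    sqrt_contraction_scalarEnergyMomentum, abs_div, abs_two]

theorem isSpacelike_of_metricTrace_eq (hε : ε = 1 ∨ ε = -1)
    (hα : ε • T = g.scalarEnergyMomentum α)
    (h : ε * g.metricTrace T = ((Module.finrank ℝ V : ℝ) - 2) *
      √(g.contraction T T / (Module.finrank ℝ V : ℝ)))
    (h0 : g.metricTrace T ≠ 0) : g.IsSpacelike α := by
  have hε0 : ε ≠ 0 := by rcases hε with rfl | rfl <;> norm_num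
  have htr := sign_mul_metricTrace hα
  -- A nonzero trace excludes both `N = 2` and `α·α = 0`, so the factor `2 - N` can be cancelled.
  obtain ⟨hN, hq⟩ := mul_ne_zero_iff.mp (htr ▸ mul_ne_zero hε0 h0)
  rw [sqrt_contraction_of_sign hε hα, htr] at h
  have h1 : g.cometric α α = -|g.cometric α α| := mul_left_cancel₀ hN (by linarith)
  rw [IsSpacelike, h1, neg_lt_zero]
  exact abs_pos.mpr fun hz => hq (by rw [hz, zero_div])

theorem isTimelike_of_metricTrace_eq (hε : ε = 1 ∨ ε = -1)
    (hα : ε • T = g.scalarEnergyMomentum α)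
    (h : ε * g.metricTrace T = (2 - (Module.finrank ℝ V : ℝ)) *
      √(g.contraction T T / (Module.finrank ℝ V : ℝ)))
    (h0 : g.metricTrace T ≠ 0) : g.IsTimelike α := by
  have hε0 : ε ≠ 0 := by rcases hε with rfl | rfl <;> norm_num
  have htr := sign_mul_metricTrace hα
  obtain ⟨hN, hq⟩ := mul_ne_zero_iff.mp (htr ▸ mul_ne_zero hε0 h0)
  rw [sqrt_contraction_of_sign hε hα, htr] at h
  have h1 : g.cometric α α = |g.cometric α α| := mul_left_cancel₀ hN (by linarith)
  rw [IsTimelike, h1]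
  exact abs_pos.mpr fun hz => hq (by rw [hz, zero_div])

theorem isNull_or_eq_zero_of_contraction_eq_zero (hε : ε = 1 ∨ ε = -1)
    (hα : ε • T = g.scalarEnergyMomentum α) (h : g.contraction T T = 0) :
    g.IsNull α ∨ (T = 0 ∧ α = 0) := by
  have hN : (Module.finrank ℝ V : ℝ) ≠ 0 := by exact_mod_cast (finrank_pos g).ne'
  have hq : g.cometric α α = 0 := by
    rw [contraction_eq_of_sign hε hα] at h
    simpa [hN] using h
  by_cases h0 : α = 0
  · refine Or.inr ⟨?_, h0⟩
    rw [← smul_smul_self_of_sign hε T, hα, h0]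
    ext u v
    simp [scalarEnergyMomentum_apply]
  · exact Or.inl ⟨h0, hq⟩

end Algebra

end LorentzForm

/-! ### Realising covectors by smooth functions, and the main theorem. -/

theorem exists_contMDiff_differentialAt_eq {N : ℕ} {M : Type*} [TopologicalSpace M] [T2Space M]
    [ChartedSpace (EuclideanSpace ℝ (Fin N)) M] [IsManifold (𝓡 N) ∞ M] (x : M)
    (α : Module.Dual ℝ (TangentSpace (𝓡 N) x)) :
    ∃ φ : M → ℝ, ContMDiff (𝓡 N) 𝓘(ℝ, ℝ) ∞ φ ∧ differentialAt φ x = α := by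
  have : IsManifold (𝓡 N) 1 M := .of_le (n := ∞) (by norm_num)
  obtain ⟨e, he⟩ : ∃ e : TangentSpace (𝓡 N) x ≃L[ℝ] EuclideanSpace ℝ (Fin N),
      ∀ v, e v = mfderiv (𝓡 N) 𝓘(ℝ, EuclideanSpace ℝ (Fin N)) (extChartAt (𝓡 N) x) x v := by
    obtain ⟨e, he⟩ := isInvertible_mfderiv_extChartAt (mem_extChartAt_source (I := 𝓡 N) x)
    exact ⟨e, fun v => DFunLike.congr_fun he v⟩
  -- `α` transported by the derivative of the chart, so that `ℓ` composed with the chart has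
  -- differential `α`; the bump function, equal to 1 near `x`, makes it global.
  set ℓ : EuclideanSpace ℝ (Fin N) →L[ℝ] ℝ :=
    LinearMap.toContinuousLinearMap (α ∘ₗ e.symm.toLinearEquiv.toLinearMap)
  obtain ⟨f⟩ : Nonempty (SmoothBumpFunction (𝓡 N) x) := inferInstance
  refine ⟨fun y => f y • ℓ (extChartAt (𝓡 N) x y), f.contMDiff_smul ?_, ?_⟩
  · exact ℓ.contMDiff.comp_contMDiffOn contMDiffOn_extChartAt
  · have h1 : (fun y => f y • ℓ (extChartAt (𝓡 N) x y)) =ᶠ[nhds x] ℓ ∘ extChartAt (𝓡 N) x := by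
      filter_upwards [f.eventuallyEq_one] with y hy
      simp [hy]
    have h2 : mfderiv (𝓡 N) 𝓘(ℝ, ℝ) (fun y => f y • ℓ (extChartAt (𝓡 N) x y)) x =
        ℓ.comp (mfderiv (𝓡 N) 𝓘(ℝ, EuclideanSpace ℝ (Fin N)) (extChartAt (𝓡 N) x) x) := by
      rw [h1.mfderiv_eq, mfderiv_comp x ℓ.mdifferentiableAt
        (mdifferentiableAt_extChartAt (mem_chart_source _ x)), ℓ.mfderiv_eq]
      rfl
    ext v
    change mfderiv (𝓡 N) 𝓘(ℝ, ℝ) (fun y => f y • ℓ (extChartAt (𝓡 N) x y)) x v = α v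
    rw [h2]
    change α (e.symm (mfderiv (𝓡 N) 𝓘(ℝ, EuclideanSpace ℝ (Fin N)) (extChartAt (𝓡 N) x) x v)) = α v
    rw [← he, e.symm_apply_apply]

theorem mainTheorem10 {N : ℕ} {M : Type*} [TopologicalSpace M] [T2Space M]
    [ChartedSpace (EuclideanSpace ℝ (Fin N)) M] [IsManifold (𝓡 N) ∞ M]
    (x : M) (g : LorentzForm (TangentSpace (𝓡 N) x))
    (T : LinearMap.BilinForm ℝ (TangentSpace (𝓡 N) x)) :
    -- up to sign, `T` is the tensor of a scalar field exactly when the conditions hold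
    ((∃ ε : ℝ, (ε = 1 ∨ ε = -1) ∧ ∃ φ : M → ℝ, IsScalarFieldTensorAt g (ε • T) φ) ↔
      ScalarRainichConditions N g T) ∧
    -- the sign is `+` exactly when `T` has the dominant property
    (∀ t, 0 < g.form t t →
      ((∃ φ : M → ℝ, IsScalarFieldTensorAt g T φ) ↔
        ScalarRainichConditions N g T ∧ g.HasDominantProperty t T)) ∧
    -- the radicand is automatically nonnegative, except in dimension two
    (N ≠ 2 → (∀ u v, T u v = T v u) → (∃ f : ℝ, g.cross T T = f • g.form) →
      0 ≤ g.contraction T T) ∧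
    -- the causal character of `dφ`
    (∀ ε : ℝ, (ε = 1 ∨ ε = -1) → ∀ φ : M → ℝ, IsScalarFieldTensorAt g (ε • T) φ →
      (ε * g.metricTrace T = ((N : ℝ) - 2) * √(g.contraction T T / (N : ℝ)) →
        g.metricTrace T ≠ 0 → g.IsSpacelike (differentialAt φ x)) ∧
      (ε * g.metricTrace T = (2 - (N : ℝ)) * √(g.contraction T T / (N : ℝ)) →
        g.metricTrace T ≠ 0 → g.IsTimelike (differentialAt φ x)) ∧
      (g.metricTrace T = 0 → g.contraction T T = 0 →
        g.IsNull (differentialAt φ x) ∨ (T = 0 ∧ differentialAt (N := N) φ x = 0))) := by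
  have hfin : Module.finrank ℝ (TangentSpace (𝓡 N) x) = N :=
    finrank_euclideanSpace_fin (𝕜 := ℝ) (n := N)
  have hex (S : LinearMap.BilinForm ℝ (TangentSpace (𝓡 N) x)) :
      (∃ φ : M → ℝ, IsScalarFieldTensorAt g S φ) ↔ ∃ α, S = g.scalarEnergyMomentum α := by
    constructor
    · rintro ⟨φ, -, h⟩
      exact ⟨_, h⟩
    · rintro ⟨α, h⟩
      obtain ⟨φ, hφ, rfl⟩ := exists_contMDiff_differentialAt_eq x α
      exact ⟨φ, hφ, h⟩
  have hiff := g.scalarRainichConditions_iff T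
  have hdom := fun t ht => g.exists_eq_scalarEnergyMomentum_iff (t := t) ht T
  have hnonneg := g.contraction_nonneg (T := T)
  rw [hfin] at hiff hnonneg
  simp only [hfin] at hdom
  refine ⟨?_, fun t ht => (hex T).trans (hdom t ht), fun hN _ => hnonneg hN, ?_⟩
  · simp only [hex]
    exact hiff.symm
  · rintro ε hε φ ⟨-, hα⟩
    refine ⟨fun h => ?_, fun h => ?_, fun _ => ?_⟩
    · exact LorentzForm.isSpacelike_of_metricTrace_eq hε hα (by rwa [hfin])
    · exact LorentzForm.isTimelike_of_metricTrace_eq hε hα (by rwa [hfin])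
    · exact LorentzForm.isNull_or_eq_zero_of_contraction_eq_zero hε hα
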